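/- **Definitions.** A polynomial $f\in\mathbb{R}[x]$ is *real stable* if it is identically zero or has only real zeros. Let $f,g\in\mathbb{R}[x]$ be nonzero and real-rooted, with zeros $r_1\ge r_2\ge\cdots$ and $s_1\ge s_2\ge\cdots$, respectively (listed with multiplicity). Write $g\preceq f$ if either $\deg f=\deg g+1=n$ and $r_n\le s_{n-1}\le\cdots\le s_2\le r_2\le s_1\le r_1$, or $\deg f=\deg g=n$ and $s_n\le r_n\le\cdots\le s_2\le r_2\le s_1\le r_1$. Write $g\ll f$ if $g\preceq f$ and the leading coefficients of $f,g$ have the same sign, or $f\preceq g$ and the leading coefficients have opposite signs; in addition, $0\ll f$ and $f\ll 0$ for every real stable $f$. **Theorem.** (A) Let $\alpha,\beta,\gamma,\mu,\nu,\varphi,\psi\in\mathbb{R}$ and $m\in\mathbb{N}$, and put $$F(x)=\alpha x^2+\beta x+\gamma,\qquad G(x)=(\alpha+m\mu)x^3+(\beta+m\nu)x^2+(\gamma+m\varphi)x+m\psi .$$ If $F\ll G$, then the operator $$\mathbb{T}=(\alpha x^2+\beta x+\gamma)I+(\mu x^3+\nu x^2+\varphi x+\psi)\frac{d}{dx}$$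 preserves real stability on polynomials of degree at most $m$: for every real stable $f\in\mathbb{R}[x]$ with $\deg f\le m$, the polynomial $\mathbb{T}f$ is real stable. (B) Let $\alpha_n,\beta_n,\gamma_n,\mu_n,\nu_n,\varphi_n,\psi_n$ be real sequences, let $n_0\in\mathbb{N}$, and let $T_n(x)\in\mathbb{R}[x]$ satisfy, for all $n\ge n_0$, $$T_{n+1}(x)=(\alpha_nx^2+\beta_nx+\gamma_n)T_n(x)+(\mu_nx^3+\nu_nx^2+\varphi_nx+\psi_n)T_n'(x).$$ Let $m_n=\deg T_n$ (with $m_n=0$ if $T_n=0$), $F_n(x)=\alpha_nx^2+\beta_nx+\gamma_n$ and $$G_n(x)=(\alpha_n+m_n\mu_n)x^3+(\beta_n+m_n\nu_n)x^2+(\gamma_n+m_n\varphi_n)x+m_n\psi_n .$$ Assume that for every $n\ge n_0$ the leading coefficients of $F_n$ and $G_n$ are positive, $0\le\deg G_n-\deg F_n\le1$, and at least one of the following holds: 1. $\deg F_n\le1$ and $\beta_n\gamma_n\varphi_n-\gamma_n^2\nu_n-\beta_n^2\psi_n\ge0$; 2. $\deg F_n=\deg G_n=2$, $\psi_n=0$,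 $m_n(\beta_n+m_n\nu_n)(\beta_n\varphi_n-\gamma_n\nu_n)-\alpha_n(\gamma_n+m_n\varphi_n)^2\ge0$, and all coefficients of $T_n(x)$ are nonnegative. If $T_{n_0}$ is real stable, then $T_n$ is real stable for all $n\ge n_0$. -/

import Mathlib

open Polynomial

/-- A real univariate polynomial is real stable if it is identically zero or has no zero in the
open upper half-plane. (For real coefficients this says that all complex zeros are real.) -/
def RealStable (f : ℝ[X]) : Prop :=
  f = 0 ∨ ∀ z : ℂ, 0 < z.im → aeval z f ≠ 0

/-- `g` interlaces `f`: both are nonzero and real-rooted, `deg f = deg g + 1 = n + 1`, and the zeros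
`r 0, …, r n` of `f` and `s 0, …, s (n - 1)` of `g`, listed with multiplicity, satisfy
`r n ≤ s (n - 1) ≤ r (n - 1) ≤ … ≤ r 1 ≤ s 0 ≤ r 0`. -/
def Interlaces (g f : ℝ[X]) : Prop :=
  g ≠ 0 ∧ f ≠ 0 ∧ ∃ (n : ℕ) (r s : ℕ → ℝ),
    f = C f.leadingCoeff * ∏ i ∈ Finset.range (n + 1), (X - C (r i)) ∧
    g = C g.leadingCoeff * ∏ i ∈ Finset.range n, (X - C (s i)) ∧
    ∀ i, i < n → r (i + 1) ≤ s i ∧ s i ≤ r i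

/-- `g` alternates left of `f`: both are nonzero and real-rooted of the same degree `n`, and the
zeros `r 0, …, r (n - 1)` of `f` and `s 0, …, s (n - 1)` of `g`, listed with multiplicity, satisfy
`s (n - 1) ≤ r (n - 1) ≤ … ≤ r 1 ≤ s 0 ≤ r 0`. -/
def AlternatesLeft (g f : ℝ[X]) : Prop :=
  g ≠ 0 ∧ f ≠ 0 ∧ ∃ (n : ℕ) (r s : ℕ → ℝ),
    f = C f.leadingCoeff * ∏ i ∈ Finset.range n, (X - C (r i)) ∧
    g = C g.leadingCoeff * ∏ i ∈ Finset.range n, (X - C (s i)) ∧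
    (∀ i, i < n → s i ≤ r i) ∧ ∀ i, i + 1 < n → r (i + 1) ≤ s i

/-- `g ⪯ f`: `g` interlaces `f` or `g` alternates left of `f`. -/
def InterlacesOrAlternates (g f : ℝ[X]) : Prop :=
  Interlaces g f ∨ AlternatesLeft g f

/-- Proper position `g ≪ f`: either `g ⪯ f` and the leading coefficients have the same sign, or
`f ⪯ g` and the leading coefficients have opposite signs; with the usual convention that
`0 ≪ f` and `f ≪ 0` for every real stable `f`. -/
def ProperPosition (g f : ℝ[X]) : Prop :=
  (InterlacesOrAlternates g f ∧ 0 < g.leadingCoeff * f.leadingCoeff) ∨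
  (InterlacesOrAlternates f g ∧ g.leadingCoeff * f.leadingCoeff < 0) ∨
  (g = 0 ∧ RealStable f) ∨ (f = 0 ∧ RealStable g)

/-- `F(x) = α x² + β x + γ`. -/
noncomputable def polyF (α β γ : ℝ) : ℝ[X] :=
  C α * X ^ 2 + C β * X + C γ

/-- `Q(x) = μ x³ + ν x² + φ x + ψ`, the coefficient of the derivative. -/
noncomputable def polyQ (μ ν φ ψ : ℝ) : ℝ[X] :=
  C μ * X ^ 3 + C ν * X ^ 2 + C φ * X + C ψ

/-- `G(x) = (α + mμ) x³ + (β + mν) x² + (γ + mφ) x + mψ`. -/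
noncomputable def polyG (α β γ μ ν φ ψ : ℝ) (m : ℕ) : ℝ[X] :=
  C (α + m * μ) * X ^ 3 + C (β + m * ν) * X ^ 2 + C (γ + m * φ) * X + C (m * ψ)

/-- The operator `T = (α x² + β x + γ) I + (μ x³ + ν x² + φ x + ψ) D` on `ℝ[x]`. -/
noncomputable def opT (α β γ μ ν φ ψ : ℝ) : ℝ[X] →ₗ[ℝ] ℝ[X] :=
  LinearMap.mulLeft ℝ (polyF α β γ) +
    (LinearMap.mulLeft ℝ (polyQ μ ν φ ψ)).comp derivative

/-! Fix `z` in the open upper half-plane and a nonzero real-rooted `f` of degree at most `m`, with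
`m > 0`. Put `h = f'(z) / (m f(z))`. This is the mean of the numbers `1/(z - r)`, `r` a zero of `f`,
padded with zeros to `m` terms. All of these lie on the circle `Im u = -Im z |u|²`, so `h` lies in
the closed disc, that is, `Im (z - 1/h) ≤ 0` when `h ≠ 0` (`RealStable.im_logDeriv`). Since `G = xF
+ mQ`, a zero of `Tf` at `z` means `G(z)/F(z) = z - 1/h`. Interlacing forces `Im (G/F) ≥ 0`, as
arguments in the upper half-plane are monotone in the zeros
(`InterlacesOrAlternates.aeval_mul_conj_aeval`). Only equality is left; there `G = cF` and `f` is a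
multiple of `(x - c)^m`, for which `Tf` vanishes identically (`RealStable.mul_add_mul_derivative`).

For (B), the first condition yields `Im (G/F) ≥ 0` by direct computation. The second uses a
half-plane in place of the disc: nonpositive zeros give `Im (z f'/f) ≥ 0`. -/

open ComplexConjugate

/-! ### Interlacing as a bound on differences of arguments -/

/-- The angle in `(0, π)` under which `z` in the upper half-plane is seen from the real point `r`. -/
noncomputable def viewAngle (z : ℂ) (r : ℝ) : ℝ := Real.pi / 2 - Real.arctan ((z.re - r) / z.im)

lemma viewAngle_strictMono {z : ℂ} (hz : 0 < z.im) : StrictMono (viewAngle z) := by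
  intro a b hab
  have : (z.re - b) / z.im < (z.re - a) / z.im := by gcongr
  have := Real.arctan_strictMono this
  unfold viewAngle
  linarith

lemma viewAngle_pos (z : ℂ) (r : ℝ) : 0 < viewAngle z r := by
  have := Real.arctan_lt_pi_div_two ((z.re - r) / z.im)
  unfold viewAngle; linarith

lemma viewAngle_lt_pi (z : ℂ) (r : ℝ) : viewAngle z r < Real.pi := by
  have := Real.neg_pi_div_two_lt_arctan ((z.re - r) / z.im)
  unfold viewAngle; linarith

lemma exists_sub_eq_mul_exp_viewAngle {z : ℂ} (hz : 0 < z.im) (r : ℝ) :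
    ∃ ρ : ℝ, 0 < ρ ∧ z - r = ρ * Complex.exp (viewAngle z r * Complex.I) := by
  set t := (z.re - r) / z.im with ht
  have hs : 0 < Real.sqrt (1 + t ^ 2) := Real.sqrt_pos.2 (by positivity)
  refine ⟨z.im * Real.sqrt (1 + t ^ 2), by positivity, ?_⟩
  apply Complex.ext
  · rw [Complex.re_ofReal_mul, Complex.exp_ofReal_mul_I_re, viewAngle, Real.cos_pi_div_two_sub,
      ← ht, Real.sin_arctan]
    simp only [Complex.sub_re, Complex.ofReal_re]
    have : z.re - r = t * z.im := by rw [ht]; field_simp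
    rw [this]; field_simp
  · rw [Complex.im_ofReal_mul, Complex.exp_ofReal_mul_I_im, viewAngle, Real.sin_pi_div_two_sub,
      ← ht, Real.cos_arctan]
    simp only [Complex.sub_im, Complex.ofReal_im]
    field_simp
    simp

lemma exists_prod_sub_eq_mul_exp {z : ℂ} (hz : 0 < z.im) (r : ℕ → ℝ) (n : ℕ) :
    ∃ ρ : ℝ, 0 < ρ ∧ ∏ i ∈ Finset.range n, (z - r i) =
      ρ * Complex.exp ((∑ i ∈ Finset.range n, viewAngle z (r i) : ℝ) * Complex.I) := by
  choose ρ hρ h using fun i => exists_sub_eq_mul_exp_viewAngle hz (r i)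
  refine ⟨∏ i ∈ Finset.range n, ρ i, Finset.prod_pos fun i _ => hρ i, ?_⟩
  push_cast
  rw [Finset.sum_mul, Complex.exp_sum, ← Finset.prod_mul_distrib]
  exact Finset.prod_congr rfl fun i _ => h i

lemma aeval_mul_conj_aeval_of_prod {z : ℂ} (hz : 0 < z.im) {f g : ℝ[X]} {r s : ℕ → ℝ} {n k : ℕ}
    (hf : f = C f.leadingCoeff * ∏ i ∈ Finset.range n, (X - C (r i)))
    (hg : g = C g.leadingCoeff * ∏ i ∈ Finset.range k, (X - C (s i))) :
    ∃ ρ : ℝ, 0 < ρ ∧ aeval z f * conj (aeval z g) =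
      ((g.leadingCoeff * f.leadingCoeff * ρ : ℝ) : ℂ) * Complex.exp
        ((∑ i ∈ Finset.range n, viewAngle z (r i) - ∑ i ∈ Finset.range k, viewAngle z (s i) : ℝ)
          * Complex.I) := by
  obtain ⟨ρ, hρ, h1⟩ := exists_prod_sub_eq_mul_exp hz r n
  obtain ⟨τ, hτ, h2⟩ := exists_prod_sub_eq_mul_exp hz s k
  refine ⟨ρ * τ, by positivity, ?_⟩
  have e1 : aeval z f = f.leadingCoeff * ∏ i ∈ Finset.range n, (z - r i) := by
    conv_lhs => rw [hf]
    simp [map_prod]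
  have e2 : aeval z g = g.leadingCoeff * ∏ i ∈ Finset.range k, (z - s i) := by
    conv_lhs => rw [hg]
    simp [map_prod]
  rw [e1, e2, h1, h2, Complex.ofReal_sub, sub_mul, sub_eq_add_neg, Complex.exp_add]
  simp only [map_mul, Complex.conj_ofReal, ← Complex.exp_conj, Complex.conj_I,
    Complex.ofReal_mul, mul_neg]
  ring

/-- Here `σ` is the sum of the angles at the zeros of `f` minus that for `g`. Interlacing makes it
an alternating sum of a monotone sequence in `(0, π)`, so it stays in `[0, π)`, and it vanishes only
if the zeros coincide. -/
lemma InterlacesOrAlternates.aeval_mul_conj_aeval {g f : ℝ[X]} (h : InterlacesOrAlternates g f)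
    {z : ℂ} (hz : 0 < z.im) :
    ∃ ρ σ : ℝ, 0 < ρ ∧ 0 ≤ σ ∧ σ < Real.pi ∧ aeval z f * conj (aeval z g) =
      ((g.leadingCoeff * f.leadingCoeff * ρ : ℝ) : ℂ) * Complex.exp (σ * Complex.I) ∧
      (σ = 0 → f = C (f.leadingCoeff / g.leadingCoeff) * g) := by
  have mono := (viewAngle_strictMono hz).monotone
  rcases h with ⟨hg0, hf0, n, r, s, hf, hg, hrs⟩ | ⟨hg0, hf0, n, r, s, hf, hg, hsr, hrs⟩
  · obtain ⟨ρ, hρ, h⟩ := aeval_mul_conj_aeval_of_prod hz hf hg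
    have hpos : 0 < ∑ i ∈ Finset.range (n + 1), viewAngle z (r i) -
        ∑ i ∈ Finset.range n, viewAngle z (s i) := by
      rw [Finset.sum_range_succ]
      have := Finset.sum_le_sum fun i hi => mono (hrs i (Finset.mem_range.1 hi)).2
      linarith [viewAngle_pos z (r n)]
    refine ⟨ρ, _, hρ, hpos.le, ?_, h, fun h0 => absurd h0 hpos.ne'⟩
    -- Splitting off `r 0` instead of `r n` pairs `s i` with `r (i + 1)`; the leftover angle is
    -- below `π`.
    rw [Finset.sum_range_succ']
    have := Finset.sum_le_sum fun i hi => mono (hrs i (Finset.mem_range.1 hi)).1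
    linarith [viewAngle_lt_pi z (r 0)]
  · obtain ⟨ρ, hρ, h⟩ := aeval_mul_conj_aeval_of_prod hz hf hg
    have hle : ∀ i ∈ Finset.range n, viewAngle z (s i) ≤ viewAngle z (r i) :=
      fun i hi => mono (hsr i (Finset.mem_range.1 hi))
    refine ⟨ρ, _, hρ, sub_nonneg.2 (Finset.sum_le_sum hle), ?_, h, fun h0 => ?_⟩
    · rcases n with _ | k
      · simpa using Real.pi_pos
      · rw [Finset.sum_range_succ', Finset.sum_range_succ]
        have := Finset.sum_le_sum fun i (hi : i ∈ Finset.range k) =>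
          mono (hrs i (by simpa using hi))
        linarith [viewAngle_lt_pi z (r 0), viewAngle_pos z (s k)]
    · have heq := (Finset.sum_eq_sum_iff_of_le hle).1 (sub_eq_zero.1 h0).symm
      have hp : ∏ i ∈ Finset.range n, (X - C (r i)) = ∏ i ∈ Finset.range n, (X - C (s i)) :=
        Finset.prod_congr rfl fun i hi => by
          rw [(viewAngle_strictMono hz).injective (heq i hi)]
      have hlc : g.leadingCoeff ≠ 0 := leadingCoeff_ne_zero.2 hg0
      conv_lhs => rw [hf, hp]
      conv_rhs => rw [hg]
      rw [← mul_assoc, ← C_mul]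
      congr 2
      have : (C g.leadingCoeff * ∏ i ∈ Finset.range n, (X - C (s i))).leadingCoeff
        = g.leadingCoeff := by rw [← hg]
      rw [this]
      field_simp

/-! ### The logarithmic derivative of a real-rooted polynomial -/

lemma Multiset.sum_map_normSq_sub (s : Multiset ℂ) (h : ℂ) :
    (s.map fun u => Complex.normSq (u - h)).sum =
      (s.map Complex.normSq).sum - 2 * (s.sum * conj h).re + s.card * Complex.normSq h := by
  induction s using Multiset.induction_on with
  | empty => simp
  | cons a s ih =>
    rw [Multiset.map_cons, Multiset.sum_cons, ih, Complex.normSq_sub, Multiset.map_cons,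
      Multiset.sum_cons, Multiset.sum_cons, Multiset.card_cons, add_mul, Complex.add_re]
    push_cast
    ring

lemma Multiset.im_sum (s : Multiset ℂ) : s.sum.im = (s.map Complex.im).sum := by
  induction s using Multiset.induction_on with
  | empty => simp
  | cons a s ih => simp [ih]

lemma RealStable.im_root_eq_zero {f : ℝ[X]} (hf : RealStable f) (hf0 : f ≠ 0) {r : ℂ}
    (hr : aeval r f = 0) : r.im = 0 := by
  have h := hf.resolve_left hf0
  rcases lt_trichotomy r.im 0 with hlt | heq | hgt
  · exact absurd (by rw [aeval_conj, hr, map_zero]) (h (conj r) (by simpa using hlt))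
  · exact heq
  · exact absurd hr (h r hgt)

lemma aeval_eq_zero_of_mem_roots_map {f : ℝ[X]} {r : ℂ}
    (hr : r ∈ (f.map (algebraMap ℝ ℂ)).roots) : aeval r f = 0 := by
  have := isRoot_of_mem_roots hr
  rwa [IsRoot, eval_map_algebraMap] at this

lemma aeval_derivative_div_aeval {f : ℝ[X]} {z : ℂ} (hz : aeval z f ≠ 0) :
    aeval z (derivative f) / aeval z f =
      ((f.map (algebraMap ℝ ℂ)).roots.map fun r => 1 / (z - r)).sum := by
  rw [← (IsAlgClosed.splits _).eval_derivative_div_eval_of_ne_zero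
    (by rwa [eval_map_algebraMap]), derivative_map, eval_map_algebraMap, eval_map_algebraMap]

lemma card_roots_map_complex (f : ℝ[X]) :
    (f.map (algebraMap ℝ ℂ)).roots.card = f.natDegree := by
  rw [← (IsAlgClosed.splits _).natDegree_eq_card_roots, natDegree_map]

lemma Complex.im_one_div_sub {z r : ℂ} (hr : r.im = 0) :
    (1 / (z - r)).im = -z.im * Complex.normSq (1 / (z - r)) := by
  rw [one_div, Complex.inv_im, Complex.normSq_inv, Complex.sub_im, hr, sub_zero]
  ring

/-- Strict convexity of the disc bounded by `Im u = -Im z |u|²`: a mean of boundary points is on the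
boundary only if they all agree. The variance identity makes this quantitative. -/
lemma RealStable.im_logDeriv {f : ℝ[X]} (hf : RealStable f) (hf0 : f ≠ 0) {m : ℕ} (hm : 0 < m)
    (hfm : f.natDegree ≤ m) {z : ℂ} (hz : 0 < z.im) {h : ℂ}
    (hh : m * h = aeval z (derivative f) / aeval z f) :
    h.im ≤ -z.im * Complex.normSq h ∧
      (h.im = -z.im * Complex.normSq h → h ≠ 0 →
        f.map (algebraMap ℝ ℂ) = C (f.leadingCoeff : ℂ) * (X - C (z - 1 / h)) ^ m) := by
  have hfz := hf.resolve_left hf0 z hz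
  rw [aeval_derivative_div_aeval hfz] at hh
  have hcard := card_roots_map_complex f
  have hroot : ∀ r ∈ (f.map (algebraMap ℝ ℂ)).roots, r.im = 0 := fun r hr =>
    hf.im_root_eq_zero hf0 (aeval_eq_zero_of_mem_roots_map hr)
  have hprod := (IsAlgClosed.splits (f.map (algebraMap ℝ ℂ))).eq_prod_roots
  set R := (f.map (algebraMap ℝ ℂ)).roots with hR
  set s := R.map fun r => 1 / (z - r) with hs
  have him : s.sum.im = -z.im * (s.map Complex.normSq).sum := by
    rw [Multiset.im_sum, hs, Multiset.map_map, Multiset.map_map, ← Multiset.sum_map_mul_left]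
    exact congrArg _ (Multiset.map_congr rfl fun r hr => Complex.im_one_div_sub (hroot r hr))
  have hvar := s.sum_map_normSq_sub h
  have hre : (s.sum * conj h).re = m * Complex.normSq h := by
    rw [← hh, mul_assoc, Complex.mul_conj, ← Complex.ofReal_natCast, ← Complex.ofReal_mul,
      Complex.ofReal_re]
  have hmim : s.sum.im = m * h.im := by
    rw [← hh, ← Complex.ofReal_natCast, Complex.im_ofReal_mul]
  rw [hre, hs, Multiset.card_map, ← hs, hcard] at hvar
  have hnn : ∀ x ∈ s.map fun u => Complex.normSq (u - h), 0 ≤ x := by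
    intro x hx
    obtain ⟨u, -, rfl⟩ := Multiset.mem_map.1 hx
    exact Complex.normSq_nonneg _
  have hsum := Multiset.sum_nonneg hnn
  have hm' : (0 : ℝ) < m := by exact_mod_cast hm
  have hdm : (f.natDegree : ℝ) ≤ m := by exact_mod_cast hfm
  have hdn : (0 : ℝ) ≤ (m - f.natDegree) * Complex.normSq h :=
    mul_nonneg (sub_nonneg.2 hdm) (Complex.normSq_nonneg h)
  -- The defect is the variance of the padded family: the last term comes from the `m - deg f`
  -- points at `0`.
  have key : m * (-z.im * Complex.normSq h - h.im) = z.im *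
      ((s.map fun u => Complex.normSq (u - h)).sum + (m - f.natDegree) * Complex.normSq h) := by
    rw [hvar, mul_sub, ← hmim, him]
    ring
  refine ⟨?_, fun heq hne => ?_⟩
  · have : 0 ≤ m * (-z.im * Complex.normSq h - h.im) := by rw [key]; positivity
    linarith [nonneg_of_mul_nonneg_right this hm']
  · rw [heq, sub_self, mul_zero, eq_comm, mul_eq_zero, or_iff_right hz.ne'] at key
    have hh0 : 0 < Complex.normSq h := Complex.normSq_pos.2 hne
    have hdeg : f.natDegree = m := by
      have : (m - f.natDegree : ℝ) * Complex.normSq h = 0 := by linarith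
      have := (mul_eq_zero.1 this).resolve_right hh0.ne'
      have : (f.natDegree : ℝ) = m := by linarith
      exact_mod_cast this
    have hall : ∀ r ∈ R, r = z - 1 / h := by
      intro r hr
      have h1 := Multiset.single_le_sum hnn _ (Multiset.mem_map_of_mem _
        (Multiset.mem_map_of_mem (fun r => 1 / (z - r)) hr))
      have h2 : Complex.normSq (1 / (z - r) - h) = 0 :=
        le_antisymm (by linarith) (Complex.normSq_nonneg _)
      rw [Complex.normSq_eq_zero, sub_eq_zero] at h2
      rw [← h2]
      simp
    rw [Multiset.eq_replicate.2 ⟨hcard.trans hdeg, hall⟩, Multiset.map_replicate,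
      Multiset.prod_replicate, leadingCoeff_map] at hprod
    exact hprod

/-! ### The operator `F + Q D` under a sign condition on `Im (G/F)` -/

lemma RealStable.mul_add_mul_derivative {F Q G : ℝ[X]} {m : ℕ} (hG : G = X * F + C (m : ℝ) * Q)
    (hF : ∀ z : ℂ, 0 < z.im → aeval z F ≠ 0)
    (him : ∀ z : ℂ, 0 < z.im → 0 ≤ (aeval z G * conj (aeval z F)).im)
    (heq : ∀ z : ℂ, 0 < z.im → (aeval z G * conj (aeval z F)).im = 0 → ∃ c : ℝ, G = C c * F)
    {f : ℝ[X]} (hfm : f.natDegree ≤ m) (hf : RealStable f) :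
    RealStable (F * f + Q * derivative f) := by
  by_cases hf0 : f = 0
  · left; simp [hf0]
  have hfz := hf.resolve_left hf0
  rcases Nat.eq_zero_or_pos m with rfl | hm
  · right
    intro z hz
    rw [derivative_of_natDegree_zero (by omega)]
    simpa using ⟨hF z hz, hfz z hz⟩
  by_contra hcon
  simp only [RealStable, not_or, not_forall, not_not] at hcon
  obtain ⟨hne, z, hz, hzero⟩ := hcon
  apply hne
  have hmC : (m : ℂ) ≠ 0 := by exact_mod_cast hm.ne'
  obtain ⟨h, hh⟩ : ∃ h : ℂ, m * h = aeval z (derivative f) / aeval z f :=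
    ⟨_, mul_div_cancel₀ _ hmC⟩
  obtain ⟨hle, hext⟩ := hf.im_logDeriv hf0 hm hfm hz hh
  have hGz : aeval z G = z * aeval z F + m * aeval z Q := by rw [hG]; simp
  have hrel : aeval z F * (1 - z * h) + aeval z G * h = 0 := by
    rw [eq_div_iff (hfz z hz)] at hh
    have : (aeval z F * (1 - z * h) + aeval z G * h) * aeval z f = 0 := by
      rw [← hzero, hGz]
      simp only [map_add, map_mul, ← hh]
      ring
    exact (mul_eq_zero.1 this).resolve_right (hfz z hz)
  have hh0 : h ≠ 0 := by
    rintro rfl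
    exact hF z hz (by simpa using hrel)
  have hFpos := Complex.normSq_pos.2 (hF z hz)
  have hhpos := Complex.normSq_pos.2 hh0
  -- This is `Im (G/F) = Im (z - 1/h)` with denominators cleared; the left side is nonnegative and
  -- the right nonpositive, so both vanish.
  have key : (aeval z G * conj (aeval z F)).im * Complex.normSq h =
      Complex.normSq (aeval z F) * (z.im * Complex.normSq h + h.im) := by
    have e : aeval z G * conj (aeval z F) * (Complex.normSq h : ℂ) =
        (Complex.normSq (aeval z F) : ℂ) * (z * (Complex.normSq h : ℂ) - conj h) := by
      rw [← Complex.mul_conj, ← Complex.mul_conj]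
      linear_combination conj (aeval z F) * conj h * hrel
    have := congrArg Complex.im e
    simpa [Complex.im_mul_ofReal, Complex.im_ofReal_mul] using this
  have h1 : 0 ≤ (aeval z G * conj (aeval z F)).im * Complex.normSq h :=
    mul_nonneg (him z hz) hhpos.le
  have h2 : z.im * Complex.normSq h + h.im = 0 := by
    rw [key] at h1
    exact le_antisymm (by linarith) (nonneg_of_mul_nonneg_right h1 hFpos)
  rw [h2, mul_zero, mul_eq_zero, or_iff_left hhpos.ne'] at key
  obtain ⟨c, hc⟩ := heq z hz key
  have hzc : z - 1 / h = c := by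
    have : aeval z F * (1 - z * h + c * h) = 0 := by
      rw [← hrel, hc]; simp; ring
    have := (mul_eq_zero.1 this).resolve_left (hF z hz)
    field_simp
    linear_combination -this
  have hfc : f = C f.leadingCoeff * (X - C c) ^ m := by
    apply map_injective (algebraMap ℝ ℂ) (algebraMap ℝ ℂ).injective
    rw [hext (by linarith) hh0, hzc]
    simp
  have hmR : (m : ℝ) ≠ 0 := by exact_mod_cast hm.ne'
  obtain ⟨k, rfl⟩ : ∃ k, m = k + 1 := ⟨m - 1, by omega⟩
  -- In the extremal case `mQ = (c - x)F`, and `Qf'` cancels `Ff` exactly.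
  have : C ((k + 1 : ℕ) : ℝ) * (F * f + Q * derivative f) = 0 := by
    have hQ : C ((k + 1 : ℕ) : ℝ) * Q = (C c - X) * F := by rw [sub_mul, ← hc, hG]; ring
    have hd : derivative f = C ((k + 1 : ℕ) : ℝ) * (C f.leadingCoeff * (X - C c) ^ k) := by
      conv_lhs => rw [hfc]
      rw [derivative_C_mul, derivative_X_sub_C_pow]
      simp
      ring
    rw [hd]
    conv_lhs => enter [2, 1]; rw [hfc]
    linear_combination C ((k + 1 : ℕ) : ℝ) * (C f.leadingCoeff * (X - C c) ^ k) * hQ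
  exact (mul_eq_zero.1 this).resolve_left (C_ne_zero.2 hmR)

lemma InterlacesOrAlternates.aeval_ne_zero {g f : ℝ[X]} (h : InterlacesOrAlternates g f)
    {z : ℂ} (hz : 0 < z.im) : aeval z g ≠ 0 ∧ aeval z f ≠ 0 := by
  obtain ⟨ρ, σ, hρ, -, -, he, -⟩ := h.aeval_mul_conj_aeval hz
  have h0 : g ≠ 0 ∧ f ≠ 0 := by
    rcases h with h | h <;> exact ⟨h.1, h.2.1⟩
  have : aeval z f * conj (aeval z g) ≠ 0 := by
    rw [he]
    refine mul_ne_zero ?_ (Complex.exp_ne_zero _)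
    simp [h0.1, h0.2, hρ.ne']
  constructor <;> rintro h1 <;> simp [h1] at this

/-- Gauss–Lucas: every term of `f'/f = ∑ 1/(z - r)` has negative imaginary part. This serves the
degenerate case `F = 0`. -/
lemma RealStable.derivative_mul {f Q : ℝ[X]} (hQ : RealStable Q) (hf : RealStable f) :
    RealStable (Q * derivative f) := by
  rcases Nat.eq_zero_or_pos f.natDegree with h0 | hpos
  · left; simp [derivative_of_natDegree_zero h0]
  rcases hQ with rfl | hQ
  · left; simp
  have hf0 : f ≠ 0 := by rintro rfl; simp at hpos
  right
  intro z hz h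
  have hfz := hf.resolve_left hf0 z hz
  rw [map_mul, mul_eq_zero, or_iff_right (hQ z hz)] at h
  have hlog := aeval_derivative_div_aeval hfz
  rw [h, zero_div] at hlog
  have him := congrArg Complex.im hlog
  rw [Multiset.im_sum, Multiset.map_map, Complex.zero_im] at him
  have hlt : ((f.map (algebraMap ℝ ℂ)).roots.map (Complex.im ∘ fun r => 1 / (z - r))).sum < 0 := by
    have hne : (f.map (algebraMap ℝ ℂ)).roots ≠ ∅ := by
      intro he
      have := card_roots_map_complex f
      rw [he] at this
      simp at this
      omega
    have := Multiset.sum_lt_sum_of_nonempty (f := Complex.im ∘ fun r => 1 / (z - r))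
      (g := fun _ => (0 : ℝ)) hne fun r hr => by
        have hr0 := aeval_eq_zero_of_mem_roots_map hr
        rw [Function.comp_apply, Complex.im_one_div_sub (hf.im_root_eq_zero hf0 hr0)]
        have : z - r ≠ 0 := fun e => hfz (by rw [sub_eq_zero.1 e, hr0])
        have := Complex.normSq_pos.2 (one_div_ne_zero this)
        nlinarith
    simpa using this
  exact hlt.ne him.symm

/-! ### Proper position implies preservation of stability -/

lemma opT_apply (α β γ μ ν φ ψ : ℝ) (f : ℝ[X]) :
    opT α β γ μ ν φ ψ f = polyF α β γ * f + polyQ μ ν φ ψ * derivative f := rfl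

lemma polyG_eq (α β γ μ ν φ ψ : ℝ) (m : ℕ) :
    polyG α β γ μ ν φ ψ m = X * polyF α β γ + C (m : ℝ) * polyQ μ ν φ ψ := by
  simp only [polyG, polyF, polyQ, C_add, C_mul]
  ring

lemma ProperPosition.realStable_mul_add_mul_derivative {F Q G : ℝ[X]} {m : ℕ}
    (h : ProperPosition F G) (hG : G = X * F + C (m : ℝ) * Q)
    {f : ℝ[X]} (hfm : f.natDegree ≤ m) (hf : RealStable f) :
    RealStable (F * f + Q * derivative f) := by
  by_cases hF0 : F = 0
  · rcases Nat.eq_zero_or_pos m with rfl | hm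
    · left
      rw [derivative_of_natDegree_zero (by omega), hF0]
      simp
    have hGs : RealStable G := by
      rcases h with ⟨h, -⟩ | ⟨h, -⟩ | ⟨-, h⟩ | ⟨h, -⟩
      · exact Or.inr fun z hz => (h.aeval_ne_zero hz).2
      · exact Or.inr fun z hz => (h.aeval_ne_zero hz).1
      · exact h
      · exact Or.inl h
    have hQ : RealStable Q := by
      rcases hGs with h | h
      · left
        rw [hF0, h] at hG
        simpa [hm.ne'] using hG.symm
      · right
        intro z hz hQ
        exact h z hz (by rw [hG, hF0]; simp [hQ])
    rw [hF0, zero_mul, zero_add]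
    exact hQ.derivative_mul hf
  rcases h with ⟨h, hl⟩ | ⟨h, hl⟩ | ⟨h, -⟩ | ⟨rfl, h⟩
  · refine RealStable.mul_add_mul_derivative hG (fun z hz => (h.aeval_ne_zero hz).1)
      (fun z hz => ?_) (fun z hz h0 => ?_) hfm hf <;>
      obtain ⟨ρ, σ, hρ, hσ, hσπ, he, hc⟩ := h.aeval_mul_conj_aeval hz
    · rw [he, Complex.im_ofReal_mul, Complex.exp_ofReal_mul_I_im]
      have := Real.sin_nonneg_of_nonneg_of_le_pi hσ hσπ.le
      positivity
    · rw [he, Complex.im_ofReal_mul, Complex.exp_ofReal_mul_I_im, mul_eq_zero,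
        or_iff_right (by positivity)] at h0
      refine ⟨_, hc (hσ.antisymm' (le_of_not_gt fun hlt => ?_))⟩
      exact (Real.sin_pos_of_pos_of_lt_pi hlt hσπ).ne' h0
  -- Swapping the roles of `F` and `G` negates the imaginary part, and the opposite leading signs
  -- negate it again.
  · have hconj : ∀ z : ℂ, (aeval z G * conj (aeval z F)).im
        = -(aeval z F * conj (aeval z G)).im := fun z => by
      simp only [Complex.mul_im, Complex.conj_re, Complex.conj_im]; ring
    refine RealStable.mul_add_mul_derivative hG (fun z hz => (h.aeval_ne_zero hz).2)
      (fun z hz => ?_) (fun z hz h0 => ?_) hfm hf <;>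
      obtain ⟨ρ, σ, hρ, hσ, hσπ, he, hc⟩ := h.aeval_mul_conj_aeval hz
    · rw [hconj, he, Complex.im_ofReal_mul, Complex.exp_ofReal_mul_I_im, ← neg_mul, mul_comm
        G.leadingCoeff, ← neg_mul]
      have := Real.sin_nonneg_of_nonneg_of_le_pi hσ hσπ.le
      have := neg_pos.2 hl
      positivity
    · rw [hconj, he, Complex.im_ofReal_mul, Complex.exp_ofReal_mul_I_im, neg_eq_zero, mul_eq_zero,
        or_iff_right (mul_ne_zero (by rw [mul_comm]; exact hl.ne) hρ.ne')] at h0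
      have hFG := hc (hσ.antisymm' (le_of_not_gt fun hlt =>
        (Real.sin_pos_of_pos_of_lt_pi hlt hσπ).ne' h0))
      have hk : F.leadingCoeff / G.leadingCoeff ≠ 0 := by
        intro hk
        rw [hk] at hFG
        exact hF0 (by simpa using hFG)
      generalize F.leadingCoeff / G.leadingCoeff = k at hFG hk
      refine ⟨k⁻¹, ?_⟩
      rw [hFG]
      rw [← mul_assoc, ← C_mul, inv_mul_cancel₀ hk, C_1, one_mul]
  · exact absurd h hF0
  · exact RealStable.mul_add_mul_derivative hG (h.resolve_left hF0) (by simp)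
      (fun _ _ _ => ⟨0, by simp⟩) hfm hf

/-! ### Explicit coefficient conditions -/

lemma aeval_polyF (α β γ : ℝ) (z : ℂ) : aeval z (polyF α β γ) = α * z ^ 2 + β * z + γ := by
  simp [polyF]

lemma aeval_polyG (α β γ μ ν φ ψ : ℝ) (m : ℕ) (z : ℂ) : aeval z (polyG α β γ μ ν φ ψ m) =
    (α + m * μ) * z ^ 3 + (β + m * ν) * z ^ 2 + (γ + m * φ) * z + m * ψ := by
  simp [polyG]

lemma coeff_polyF_two (α β γ : ℝ) : (polyF α β γ).coeff 2 = α := by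
  simp [polyF]

lemma coeff_polyF_one (α β γ : ℝ) : (polyF α β γ).coeff 1 = β := by
  simp [polyF, coeff_C, coeff_X_pow]

lemma coeff_polyG_three (α β γ μ ν φ ψ : ℝ) (m : ℕ) :
    (polyG α β γ μ ν φ ψ m).coeff 3 = α + m * μ := by
  simp [polyG, coeff_X_pow, -map_add, -map_mul]

lemma coeff_polyG_two (α β γ μ ν φ ψ : ℝ) (m : ℕ) :
    (polyG α β γ μ ν φ ψ m).coeff 2 = β + m * ν := by
  simp [polyG, coeff_X_pow, -map_add, -map_mul]

lemma coeff_polyG_one (α β γ μ ν φ ψ : ℝ) (m : ℕ) :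
    (polyG α β γ μ ν φ ψ m).coeff 1 = γ + m * φ := by
  simp [polyG, coeff_X_pow, coeff_C, -map_add, -map_mul]

lemma coeff_nonneg_of_leadingCoeff_pos {p : ℝ[X]} {k : ℕ} (hp : 0 < p.leadingCoeff)
    (hk : p.natDegree ≤ k) : 0 ≤ p.coeff k := by
  rcases hk.eq_or_lt with rfl | hlt
  · exact hp.le
  · rw [coeff_eq_zero_of_natDegree_lt hlt]

lemma realStable_of_natDegree_polyF_le_one {α β γ μ ν φ ψ : ℝ} {m : ℕ}
    (hF : 0 < (polyF α β γ).leadingCoeff) (hG : 0 < (polyG α β γ μ ν φ ψ m).leadingCoeff)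
    (hdeg : (polyG α β γ μ ν φ ψ m).natDegree ≤ (polyF α β γ).natDegree + 1)
    (hF1 : (polyF α β γ).natDegree ≤ 1)
    (hc : 0 ≤ β * γ * φ - γ ^ 2 * ν - β ^ 2 * ψ)
    {f : ℝ[X]} (hfm : f.natDegree ≤ m) (hf : RealStable f) :
    RealStable (polyF α β γ * f + polyQ μ ν φ ψ * derivative f) := by
  have hα : α = 0 := by
    rw [← coeff_polyF_two α β γ]; exact coeff_eq_zero_of_natDegree_lt (by omega)
  have hμ : α + m * μ = 0 := by
    rw [← coeff_polyG_three α β γ μ ν φ ψ]; exact coeff_eq_zero_of_natDegree_lt (by omega)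
  have hB : 0 ≤ β + m * ν := by
    rw [← coeff_polyG_two α β γ μ ν φ ψ]
    exact coeff_nonneg_of_leadingCoeff_pos hG (by omega)
  have hm0 : (0 : ℝ) ≤ m := m.cast_nonneg
  have him : ∀ z : ℂ, (aeval z (polyG α β γ μ ν φ ψ m) * conj (aeval z (polyF α β γ))).im =
      z.im * (β * (β + m * ν) * Complex.normSq z + 2 * (β + m * ν) * γ * z.re
        + (γ + m * φ) * γ - β * (m * ψ)) := by
    intro z
    have hμ' : (α : ℂ) + m * μ = 0 := by exact_mod_cast hμ
    rw [aeval_polyG, aeval_polyF, hμ', hα]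
    simp only [Complex.normSq_apply, Complex.add_im, Complex.add_re, Complex.mul_im,
      Complex.mul_re, Complex.conj_im, Complex.conj_re, Complex.ofReal_im, Complex.ofReal_re,
      Complex.natCast_im, Complex.natCast_re, pow_succ, pow_zero, one_mul, Complex.zero_im,
      Complex.zero_re]
    ring
  by_cases hβ : β = 0
  · have hF0 : (polyF α β γ).natDegree = 0 := by simp [polyF, hα, hβ]
    have hγ : 0 < γ := by
      rw [polyF, hα, hβ] at hF
      simpa using hF
    have hν : β + m * ν = 0 := by
      rw [← coeff_polyG_two α β γ μ ν φ ψ]; exact coeff_eq_zero_of_natDegree_lt (by omega)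
    have hC : 0 ≤ γ + m * φ := by
      rw [← coeff_polyG_one α β γ μ ν φ ψ]
      exact coeff_nonneg_of_leadingCoeff_pos hG (by omega)
    refine RealStable.mul_add_mul_derivative (polyG_eq α β γ μ ν φ ψ m) (fun z hz => ?_)
      (fun z hz => ?_) (fun z hz h0 => ?_) hfm hf
    · rw [aeval_polyF, hα, hβ]
      simpa using hγ.ne'
    · rw [him, hν, hβ]
      have : 0 ≤ (γ + m * φ) * γ := by positivity
      apply mul_nonneg hz.le
      linarith
    · rw [him, hν, hβ, mul_eq_zero, or_iff_right hz.ne'] at h0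
      have : (γ + m * φ) * γ = 0 := by linarith
      have h1 := (mul_eq_zero.1 this).resolve_right hγ.ne'
      refine ⟨m * ψ / γ, ?_⟩
      rw [polyG, polyF, h1, hν, hμ, hα, hβ]
      simp only [C_0, zero_mul, zero_add]
      rw [← C_mul]
      field_simp
  · have hβ : 0 < β := by
      have h1 : (polyF α β γ).natDegree = 1 := by
        refine le_antisymm hF1 (le_natDegree_of_ne_zero ?_)
        rwa [coeff_polyF_one]
      rw [leadingCoeff, h1, coeff_polyF_one] at hF
      exact hF
    -- Completing the square: after multiplication by `β`, the first condition of (B) is the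
    -- constant term.
    have hform : ∀ z : ℂ, β * (β * (β + m * ν) * Complex.normSq z + 2 * (β + m * ν) * γ * z.re
        + (γ + m * φ) * γ - β * (m * ψ)) = (β + m * ν) * Complex.normSq (β * z + γ)
        + m * (β * γ * φ - γ ^ 2 * ν - β ^ 2 * ψ) := by
      intro z
      simp only [Complex.normSq_apply, Complex.add_im, Complex.add_re, Complex.mul_im,
        Complex.mul_re, Complex.ofReal_im, Complex.ofReal_re]
      ring
    have hne : ∀ z : ℂ, 0 < z.im → (β * z + γ : ℂ) ≠ 0 := fun z hz h => by
      have := congrArg Complex.im h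
      simp [hβ.ne', hz.ne'] at this
    refine RealStable.mul_add_mul_derivative (polyG_eq α β γ μ ν φ ψ m) (fun z hz => ?_)
      (fun z hz => ?_) (fun z hz h0 => ?_) hfm hf
    · rw [aeval_polyF, hα]
      simpa using hne z hz
    · rw [him]
      refine mul_nonneg hz.le (nonneg_of_mul_nonneg_right ?_ hβ)
      rw [hform]
      have := Complex.normSq_nonneg (β * z + γ)
      positivity
    · rw [him, mul_eq_zero, or_iff_right hz.ne'] at h0
      have h1 := hform z
      rw [h0, mul_zero] at h1
      have hpos := Complex.normSq_pos.2 (hne z hz)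
      have h2 : 0 ≤ m * (β * γ * φ - γ ^ 2 * ν - β ^ 2 * ψ) := by positivity
      have h3 : β + m * ν = 0 := by
        by_contra hB0
        have := mul_pos (hB.lt_of_ne' hB0) hpos
        linarith
      simp only [h3, mul_zero, zero_mul, zero_add] at h0
      refine ⟨(γ + m * φ) / β, ?_⟩
      have h4 : (γ + m * φ) / β * γ = m * ψ := by field_simp; linarith
      have h5 : (γ + m * φ) / β * β = γ + m * φ := by field_simp
      rw [polyG, polyF, h3, hμ, hα]
      simp only [C_0, zero_mul, zero_add]
      rw [mul_add, ← mul_assoc, ← C_mul, ← C_mul, h4, h5]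

/-- Nonnegative coefficients exclude positive zeros, and `Im (z/(z - r)) = -r Im z / |z - r|²`. -/
lemma RealStable.im_mul_logDeriv_nonneg {f : ℝ[X]} (hf : RealStable f) (hf0 : f ≠ 0)
    (hcoeff : ∀ k, 0 ≤ f.coeff k) {z : ℂ} (hz : 0 < z.im) :
    0 ≤ (z * (aeval z (derivative f) / aeval z f)).im := by
  have hfz := hf.resolve_left hf0 z hz
  rw [aeval_derivative_div_aeval hfz, ← Multiset.sum_map_mul_left, Multiset.im_sum,
    Multiset.map_map]
  refine Multiset.sum_nonneg fun x hx => ?_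
  obtain ⟨r, hr, rfl⟩ := Multiset.mem_map.1 hx
  have hr0 := aeval_eq_zero_of_mem_roots_map hr
  have him := hf.im_root_eq_zero hf0 hr0
  have hre : r.re ≤ 0 := by
    by_contra! hpos
    have hrr : r = (algebraMap ℝ ℂ) r.re := Complex.ext (by simp) (by simp [him])
    rw [hrr, aeval_algebraMap_apply_eq_algebraMap_eval, map_eq_zero,
      eval_eq_sum_range] at hr0
    have hle : f.leadingCoeff * r.re ^ f.natDegree ≤ 0 := hr0 ▸ Finset.single_le_sum
      (f := fun i => f.coeff i * r.re ^ i)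
      (fun i _ => mul_nonneg (hcoeff i) (pow_nonneg hpos.le i)) (Finset.self_mem_range_succ _)
    have hlc : 0 < f.leadingCoeff := (hcoeff _).lt_of_ne' (leadingCoeff_ne_zero.2 hf0)
    have := pow_pos hpos f.natDegree
    nlinarith
  rw [Function.comp_apply, mul_one_div, Complex.div_im, Complex.sub_re, Complex.sub_im, him,
    sub_zero, ← sub_div]
  refine div_nonneg ?_ (Complex.normSq_nonneg _)
  nlinarith

/-- As `ψ = 0`, `G = x(Bx + D)`. With `p = z f'/(m f)`, a zero of the image gives `F/(Bz + D) = p/(p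
- 1)`, whose imaginary part has the sign of `-Im p ≤ 0`, while the coefficient inequality makes the
left side's positive. No degree bound on `f` enters: `m` only rescales `p`. -/
lemma realStable_of_natDegree_polyF_eq_two {α β γ μ ν φ : ℝ} {m : ℕ}
    (hF : 0 < (polyF α β γ).leadingCoeff) (hG : 0 < (polyG α β γ μ ν φ 0 m).leadingCoeff)
    (hF2 : (polyF α β γ).natDegree = 2) (hG2 : (polyG α β γ μ ν φ 0 m).natDegree = 2)
    (hc : 0 ≤ m * (β + m * ν) * (β * φ - γ * ν) - α * (γ + m * φ) ^ 2)
    {f : ℝ[X]} (hcoeff : ∀ k, 0 ≤ f.coeff k) (hf : RealStable f) :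
    RealStable (polyF α β γ * f + polyQ μ ν φ 0 * derivative f) := by
  by_cases hf0 : f = 0
  · left; simp [hf0]
  rw [leadingCoeff, hF2, coeff_polyF_two] at hF
  rw [leadingCoeff, hG2, coeff_polyG_two] at hG
  have hμ : α + m * μ = 0 := by
    rw [← coeff_polyG_three α β γ μ ν φ 0]; exact coeff_eq_zero_of_natDegree_lt (by omega)
  have hm : (m : ℝ) ≠ 0 := by
    intro h
    rw [h] at hμ
    linarith
  have hm0 : (0 : ℝ) < m := m.cast_nonneg.lt_of_ne' hm
  right
  intro z hz hzero
  have hfz := hf.resolve_left hf0 z hz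
  set B := β + m * ν with hB
  set D := γ + m * φ with hD
  obtain ⟨p, hp⟩ : ∃ p, m * p = z * (aeval z (derivative f) / aeval z f) :=
    ⟨_, mul_div_cancel₀ _ (by exact_mod_cast hm)⟩
  have hpim : 0 ≤ p.im := by
    have := hf.im_mul_logDeriv_nonneg hf0 hcoeff hz
    rw [← hp, ← Complex.ofReal_natCast, Complex.im_ofReal_mul] at this
    exact nonneg_of_mul_nonneg_right this hm0
  have hrel : aeval z (polyF α β γ) * (1 - p) + (B * z + D) * p = 0 := by
    have h1 : aeval z (polyF α β γ) + aeval z (polyQ μ ν φ 0) *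
        (aeval z (derivative f) / aeval z f) = 0 := by
      rw [map_add, map_mul, map_mul] at hzero
      field_simp
      linear_combination hzero
    have h2 : aeval z (polyG α β γ μ ν φ 0 m) = z * (B * z + D) := by
      have hμ' : (α : ℂ) + m * μ = 0 := by exact_mod_cast hμ
      rw [aeval_polyG, hμ', hB, hD]
      push_cast
      ring
    rw [polyG_eq] at h2
    simp only [map_add, map_mul, aeval_X, aeval_C] at h2
    have hz0 : z ≠ 0 := by rintro rfl; simp at hz
    apply mul_left_cancel₀ hz0
    simp only [Complex.coe_algebraMap, Complex.ofReal_natCast] at h2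
    linear_combination z * h1 - p * h2 + aeval z (polyQ μ ν φ 0) * hp
  have hEim : 0 < (aeval z (polyF α β γ) * conj (B * z + D)).im := by
    -- The factor `B²` permits completing the square in `Bz + D`; the remainder is the assumed
    -- inequality.
    have e : (aeval z (polyF α β γ) * conj (B * z + D)).im * B ^ 2 = z.im * B *
        (α * Complex.normSq (B * z + D) + (m * B * (β * φ - γ * ν) - α * D ^ 2)) := by
      rw [aeval_polyF, hB, hD]
      simp only [Complex.normSq_apply, Complex.add_im, Complex.add_re, Complex.mul_im,
        Complex.mul_re, Complex.conj_im, Complex.conj_re, Complex.ofReal_im, Complex.ofReal_re,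
        pow_succ, pow_zero, one_mul]
      ring
    have hne : (B * z + D : ℂ) ≠ 0 := fun h => by
      have := congrArg Complex.im h
      simp [hG.ne', hz.ne'] at this
    have := Complex.normSq_pos.2 hne
    have : 0 < (aeval z (polyF α β γ) * conj (B * z + D)).im * B ^ 2 := by
      rw [e]
      have : 0 < α * Complex.normSq (B * z + D) := by positivity
      positivity
    exact pos_of_mul_pos_left this (by positivity)
  have e2 : (aeval z (polyF α β γ) * conj (B * z + D)).im * Complex.normSq (1 - p) =
      -(Complex.normSq (B * z + D) * p.im) := by
    have e : aeval z (polyF α β γ) * conj (B * z + D) * (Complex.normSq (1 - p) : ℂ) =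
        (Complex.normSq (B * z + D) : ℂ) * -(p - (Complex.normSq p : ℂ)) := by
      rw [← Complex.mul_conj, ← Complex.mul_conj, ← Complex.mul_conj, map_sub, map_one]
      linear_combination conj (B * z + D : ℂ) * (1 - conj p) * hrel
    have := congrArg Complex.im e
    rw [Complex.im_mul_ofReal, Complex.im_ofReal_mul] at this
    simpa using this
  -- The signs in `e2` leave only the pole `p = 1`, where `hrel` forces `Bz + D = 0`, contradicting
  -- `hEim`.
  have h3 : Complex.normSq (1 - p) = 0 := by
    have h4 := mul_nonneg (Complex.normSq_nonneg (B * z + D)) hpim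
    have h5 := Complex.normSq_nonneg (1 - p)
    by_contra h6
    have := mul_pos hEim (h5.lt_of_ne' h6)
    linarith
  rw [Complex.normSq_eq_zero] at h3
  have hp1 : p = 1 := (sub_eq_zero.1 h3).symm
  rw [hp1] at hrel
  have hne : (B * z + D : ℂ) = 0 := by linear_combination hrel
  rw [hne] at hEim
  simp at hEim

theorem mainTheorem1 :
    -- The operator preserves real stability on polynomials of degree at most `m` if `F ≪ G`.
    (∀ (α β γ μ ν φ ψ : ℝ) (m : ℕ),
      ProperPosition (polyF α β γ) (polyG α β γ μ ν φ ψ m) →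
      ∀ f : ℝ[X], f.natDegree ≤ m → RealStable f → RealStable (opT α β γ μ ν φ ψ f)) ∧
    -- Explicit conditions under which real stability of `T n₀` propagates to all `n ≥ n₀`.
    (∀ (α β γ μ ν φ ψ : ℕ → ℝ) (T : ℕ → ℝ[X]) (n₀ : ℕ) (F G : ℕ → ℝ[X]) (m : ℕ → ℕ),
      (∀ n, n₀ ≤ n → T (n + 1) =
        (C (α n) * X ^ 2 + C (β n) * X + C (γ n)) * T n +
        (C (μ n) * X ^ 3 + C (ν n) * X ^ 2 + C (φ n) * X + C (ψ n)) * derivative (T n)) →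
      (∀ n, m n = (T n).natDegree) →
      (∀ n, F n = polyF (α n) (β n) (γ n)) →
      (∀ n, G n = polyG (α n) (β n) (γ n) (μ n) (ν n) (φ n) (ψ n) (m n)) →
      (∀ n, n₀ ≤ n → 0 < (F n).leadingCoeff ∧ 0 < (G n).leadingCoeff ∧
        (F n).natDegree ≤ (G n).natDegree ∧ (G n).natDegree ≤ (F n).natDegree + 1) →
      (∀ n, n₀ ≤ n →
        ((F n).natDegree ≤ 1 ∧
          0 ≤ β n * γ n * φ n - γ n ^ 2 * ν n - β n ^ 2 * ψ n) ∨
        ((F n).natDegree = 2 ∧ (G n).natDegree = 2 ∧ ψ n = 0 ∧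
          0 ≤ m n * (β n + m n * ν n) * (β n * φ n - γ n * ν n)
            - α n * (γ n + m n * φ n) ^ 2 ∧
          ∀ k, 0 ≤ (T n).coeff k)) →
      RealStable (T n₀) → ∀ n, n₀ ≤ n → RealStable (T n)) := by
  refine ⟨fun α β γ μ ν φ ψ m h f hfm hf => ?_, ?_⟩
  · rw [opT_apply]
    exact h.realStable_mul_add_mul_derivative (polyG_eq α β γ μ ν φ ψ m) hfm hf
  · intro α β γ μ ν φ ψ T n₀ F G m hT hm hF hG hlead hcond h0 n hn
    induction n, hn using Nat.le_induction with
    | base => exact h0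
    | succ n hn ih =>
      have hstep : T (n + 1) = polyF (α n) (β n) (γ n) * T n +
          polyQ (μ n) (ν n) (φ n) (ψ n) * derivative (T n) := hT n hn
      obtain ⟨hFl, hGl, -, hdeg⟩ := hlead n hn
      have hc := hcond n hn
      rw [hF] at hFl hdeg hc
      rw [hG] at hGl hdeg hc
      rw [hstep]
      rcases hc with ⟨hF1, hc⟩ | ⟨hF2, hG2, hψ, hc, hcoeff⟩
      · exact realStable_of_natDegree_polyF_le_one hFl hGl hdeg hF1 hc (hm n).ge ih
      · rw [hψ] at hGl hG2 ⊢
        exact realStable_of_natDegree_polyF_eq_two hFl hGl hF2 hG2 hc hcoeff ih
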